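/- Let $\Sigma_{cm}$ be the signature with constants $0,1,\bot$, a unary operation $-$, and binary operations $+,\cdot,/$. For a field $F$, the common meadow $Enl_\bot(F(\_/\_))$ is the $\Sigma_{cm}$-algebra with carrier $F\cup\{\bot\}$, $\bot\notin F$, in which $0,1,-,+,\cdot$ are as in $F$ on arguments from $F$, every operation returns $\bot$ as soon as one of its arguments is $\bot$, and for $x,y\in F$ one has $x/y=x\cdot y^{-1}$ if $y\neq 0$ and $x/0=\bot$. Let $E_{\mathsf{ftc\text{-}cm}}$ be the following set of 18 equations in variables $x,y,z,u,v$: 1. $(x+y)+z=x+(y+z)$ 2. $x+y=y+x$ 3. $x+0=x$ 4. $x+(-x)=0\cdot x$ 5. $x\cdot(y\cdot z)=(x\cdot y)\cdot z$ 6. $x\cdot y=y\cdot x$ 7. $1\cdot x=x$ 8. $x\cdot(y+z)=(x\cdot y)+(x\cdot z)$ 9. $-(-x)=x$ 10. $0\cdot(x+y)=0\cdot(x\cdot y)$ 11. $x+\bot=\bot$ 12. $x=\frac{x}{1}$ 13. $-\frac{x}{y}=\frac{-x}{y}$ 14. $\frac{x}{y}\cdot\frac{u}{v}=\frac{x\cdot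 u}{y\cdot v}$ 15. $\frac{x}{y}+\frac{u}{v}=\frac{(x\cdot v)+(y\cdot u)}{y\cdot v}$ 16. $\frac{x}{\left(\frac{u}{v}\right)}=x\cdot\frac{v\cdot v}{u\cdot v}$ 17. $\frac{x}{y+0\cdot z}=\frac{x+0\cdot z}{y}$ 18. $\bot=\frac{1}{0}$ **Theorem.** The set $E_{\mathsf{ftc\text{-}cm}}$ is finite, and it is sound and complete for the equational theory of common meadows: for all terms $t,r$ over $\Sigma_{cm}$ with variables from a countably infinite set, $E_{\mathsf{ftc\text{-}cm}}\vdash t=r$ in equational logic (reflexivity, symmetry, transitivity, congruence for all operations, and substitution) if and only if, for every field $F$, the equation $t=r$ holds in $Enl_\bot(F(\_/\_))$ under all valuations of the variables in $F\cup\{\bot\}$. -/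

import Mathlib

universe u

namespace CommonMeadow

/-- Terms over the signature `Σ_cm` (constants `0`, `1`, `⊥`, unary `-`, binary `+`, `·`, `/`),
with variables from the countably infinite set `X₀, X₁, X₂, …`. -/
inductive Term : Type
  | var : ℕ → Term
  | zero : Term
  | one : Term
  | bot : Term
  | neg : Term → Term
  | add : Term → Term → Term
  | mul : Term → Term → Term
  | div : Term → Term → Term

instance : Zero Term := ⟨Term.zero⟩
instance : One Term := ⟨Term.one⟩
instance : Bot Term := ⟨Term.bot⟩
instance : Neg Term := ⟨Term.neg⟩
instance : Add Term := ⟨Term.add⟩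
instance : Mul Term := ⟨Term.mul⟩
instance : Div Term := ⟨Term.div⟩

/-- Simultaneous substitution of terms for variables. -/
def Term.subst (σ : ℕ → Term) : Term → Term
  | .var n => σ n
  | .zero => .zero
  | .one => .one
  | .bot => .bot
  | .neg t => .neg (t.subst σ)
  | .add s t => .add (s.subst σ) (t.subst σ)
  | .mul s t => .mul (s.subst σ) (t.subst σ)
  | .div s t => .div (s.subst σ) (t.subst σ)

/-- An equation over `Σ_cm`: a pair of terms. -/
structure Equation : Type where
  lhs : Term
  rhs : Term

/-- `s ≐ t` is the formal equation between the terms `s` and `t`. -/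
infix:50 " ≐ " => Equation.mk

/-- A (total, single-sorted) `Σ_cm`-algebra with carrier `A`. -/
structure CMAlgebra (A : Type u) : Type u where
  zero : A
  one : A
  bot : A
  neg : A → A
  add : A → A → A
  mul : A → A → A
  div : A → A → A

/-- The value of a term in the algebra `𝔸` under the valuation `ρ`. -/
def Term.eval {A : Type u} (𝔸 : CMAlgebra A) (ρ : ℕ → A) : Term → A
  | .var n => ρ n
  | .zero => 𝔸.zero
  | .one => 𝔸.one
  | .bot => 𝔸.bot
  | .neg t => 𝔸.neg (t.eval 𝔸 ρ)
  | .add s t => 𝔸.add (s.eval 𝔸 ρ) (t.eval 𝔸 ρ)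
  | .mul s t => 𝔸.mul (s.eval 𝔸 ρ) (t.eval 𝔸 ρ)
  | .div s t => 𝔸.div (s.eval 𝔸 ρ) (t.eval 𝔸 ρ)

/-- `𝔸 ⊨ e`: the equation holds in `𝔸` under all valuations. -/
def CMAlgebra.Satisfies {A : Type u} (𝔸 : CMAlgebra A) (e : Equation) : Prop :=
  ∀ ρ : ℕ → A, e.lhs.eval 𝔸 ρ = e.rhs.eval 𝔸 ρ

/-- `Derivable E e` is `E ⊢ e` in equational logic. -/
inductive Derivable (E : Set Equation) : Equation → Prop
  | ax {e : Equation} : e ∈ E → Derivable E e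
  | refl (t : Term) : Derivable E (t ≐ t)
  | symm {s t : Term} : Derivable E (s ≐ t) → Derivable E (t ≐ s)
  | trans {s t r : Term} : Derivable E (s ≐ t) → Derivable E (t ≐ r) → Derivable E (s ≐ r)
  | subst {s t : Term} (σ : ℕ → Term) :
      Derivable E (s ≐ t) → Derivable E (s.subst σ ≐ t.subst σ)
  | neg_congr {s t : Term} : Derivable E (s ≐ t) → Derivable E (-s ≐ -t)
  | add_congr {s s' t t' : Term} :
      Derivable E (s ≐ s') → Derivable E (t ≐ t') → Derivable E (s + t ≐ s' + t')
  | mul_congr {s s' t t' : Term} :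
      Derivable E (s ≐ s') → Derivable E (t ≐ t') → Derivable E (s * t ≐ s' * t')
  | div_congr {s s' t t' : Term} :
      Derivable E (s ≐ s') → Derivable E (t ≐ t') → Derivable E (s / t ≐ s' / t')

/-- The equations `E_{wcr,⊥}` of weak commutative rings with `⊥`. -/
def wcrBot : Set Equation :=
  let x := Term.var 0
  let y := Term.var 1
  let z := Term.var 2
  { (x + y) + z ≐ x + (y + z),
    x + y ≐ y + x,
    x + 0 ≐ x,
    x + (-x) ≐ 0 * x,
    x * (y * z) ≐ (x * y) * z,
    x * y ≐ y * x,
    1 * x ≐ x,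
    x * (y + z) ≐ (x * y) + (x * z),
    -(-x) ≐ x,
    0 * (x + y) ≐ 0 * (x * y),
    x + ⊥ ≐ ⊥ }

/-- The equations `E_{ftc-cm}`: those of `E_{wcr,⊥}` together with seven axioms for division. -/
def ftcCm : Set Equation :=
  let x := Term.var 0
  let y := Term.var 1
  let z := Term.var 2
  let u := Term.var 3
  let v := Term.var 4
  wcrBot ∪
  { x ≐ x / 1,
    -(x / y) ≐ (-x) / y,
    (x / y) * (u / v) ≐ (x * u) / (y * v),
    (x / y) + (u / v) ≐ ((x * v) + (y * u)) / (y * v),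
    x / (u / v) ≐ x * ((v * v) / (u * v)),
    x / (y + 0 * z) ≐ (x + 0 * z) / y,
    ⊥ ≐ 1 / 0 }

open Classical in
/-- The partial division of a field: `x / y` is undefined (`none`) exactly when `y = 0`. -/
noncomputable def partialDiv {F : Type u} [Field F] (x y : F) : Option F :=
  if y = 0 then none else some (x * y⁻¹)

/-- The common meadow `Enl_⊥(F(_/_))` on the carrier `F ∪ {⊥}`, modelled by `Option F`
with `⊥ = none`. Each operation returns `⊥` when some argument is `⊥`,
and when it is undefined in `F`. -/
noncomputable def enl (F : Type u) [Field F] : CMAlgebra (Option F) where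
  zero := some 0
  one := some 1
  bot := none
  neg
    | some x => some (-x)
    | none => none
  add
    | some x, some y => some (x + y)
    | _, _ => none
  mul
    | some x, some y => some (x * y)
    | _, _ => none
  div
    | some x, some y => partialDiv x y
    | _, _ => none

end CommonMeadow

namespace CommonMeadow

open MvPolynomial

/-! Soundness is a case check; completeness rests on two observations. Syntactically, in any model
the elements sharing a given value of `0 · x` form a commutative ring, even though the whole model
does not. For a term `t` with variable set `V`, the error term `0 · ∑ Xᵢ` over `V` is absorbed by
`t` and selects such a ring, into which `ℤ[X]` maps. Hence `t` is provably a flat fraction `p / q`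
of images of integer polynomials (`cls_eq_div`). Such a fraction may be expanded by any divisor of a
power of its denominator (`Fiber.div_eq_mul_div_mul_of_dvd_pow`). Semantically, `p / q` is undefined
exactly where `q` vanishes. Testing a valid equation in the residue field of every prime of `ℤ[X]`
shows that the two denominators lie in the same primes, so each divides a power of the other
(`exists_dvd_pow`). If they are zero, both terms are `⊥`. Otherwise the fraction field of `ℤ[X]`
gives `p q' = p' q`, valuations using `⊥` force equal variable sets, and expanding both fractions to
the denominator `q q'` identifies them (`cls_eq_of_frac`). -/

/-- Algebras satisfying the equations `E_{ftc-cm}`. -/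
class FtcAlgebra (A : Type u) extends
    AddCommMonoid A, CommMonoid A, Distrib A, InvolutiveNeg A, Div A, Bot A where
  add_neg_self (x : A) : x + -x = 0 * x
  zero_mul_add_eq (x y : A) : 0 * (x + y) = 0 * (x * y)
  add_bot (x : A) : x + ⊥ = ⊥
  div_one_eq (x : A) : x / 1 = x
  neg_div_eq (x y : A) : -(x / y) = (-x) / y
  div_mul_div_eq (x y u v : A) : (x / y) * (u / v) = (x * u) / (y * v)
  div_add_div_eq (x y u v : A) : (x / y) + (u / v) = ((x * v) + (y * u)) / (y * v)
  div_div_eq (x u v : A) : x / (u / v) = x * ((v * v) / (u * v))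
  div_add_zero_mul (x y z : A) : x / (y + 0 * z) = (x + 0 * z) / y
  bot_eq : (⊥ : A) = 1 / 0

/-! ### Consequences of the axioms in an arbitrary model -/

namespace FtcAlgebra

variable {A : Type u} [FtcAlgebra A]

theorem add_zero_mul_self (x : A) : x + 0 * x = x := by
  have h := add_mul (1 : A) 0 x
  rwa [add_zero, one_mul, eq_comm] at h

theorem zero_mul_mul (x y : A) : 0 * (x * y) = 0 * x + 0 * y := by
  rw [← zero_mul_add_eq, mul_add]

theorem zero_mul_add_zero_mul (x : A) : 0 * x + 0 * x = 0 * x := by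
  rw [← add_mul, add_zero]

theorem zero_mul_zero : (0 : A) * 0 = 0 := by
  simpa using add_zero_mul_self (0 : A)

theorem zero_mul_zero_mul (x : A) : (0 : A) * (0 * x) = 0 * x := by
  rw [← mul_assoc, zero_mul_zero]

theorem zero_mul_neg (x : A) : 0 * (-x) = 0 * x := by
  rw [← add_neg_self, ← add_neg_self, neg_neg, add_comm]

/-- Uniqueness of inverses survives without cancellation: both sides complement `x` to `0 * x`, and
each absorbs `0 * x`. -/
theorem neg_eq_neg_one_mul (x : A) : -x = (-1) * x := by
  have h : x + (-1) * x = 0 * x := by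
    have := add_mul (1 : A) (-1) x
    rw [add_neg_self, mul_one, one_mul] at this
    exact this.symm
  calc -x = -x + 0 * (-x) := (add_zero_mul_self _).symm
    _ = (x + -x) + (-1) * x := by
      rw [zero_mul_neg, ← h, add_comm x (-x), add_assoc]
    _ = (-1) * x + 0 * ((-1) * x) := by
      rw [add_neg_self, zero_mul_mul, zero_mul_neg, mul_one, zero_add, add_comm]
    _ = (-1) * x := add_zero_mul_self _

theorem neg_add_eq (x y : A) : -(x + y) = -x + -y := by
  rw [neg_eq_neg_one_mul, mul_add, ← neg_eq_neg_one_mul, ← neg_eq_neg_one_mul]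

theorem neg_zero_mul (x : A) : -(0 * x) = 0 * x := by
  rw [← add_neg_self, neg_add_eq, neg_neg, add_comm]

theorem bot_add (x : A) : ⊥ + x = ⊥ := by rw [add_comm, add_bot]

theorem mul_bot (x : A) : x * ⊥ = ⊥ := by
  have h : (0 : A) * ⊥ = ⊥ := by rw [← add_neg_self, bot_add]
  rw [← add_zero_mul_self (x * ⊥), zero_mul_mul, h, add_bot, add_bot]

theorem div_eq_mul_one_div (x y : A) : x / y = x * (1 / y) := by
  have h := div_mul_div_eq x 1 1 y
  rwa [div_one_eq, mul_one, one_mul, eq_comm] at h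

theorem div_zero_eq_bot (x : A) : x / 0 = ⊥ := by
  rw [div_eq_mul_one_div, ← bot_eq, mul_bot]

theorem div_zero_mul (x y : A) : x / (0 * y) = ⊥ := by
  rw [← zero_add (0 * y), div_add_zero_mul, div_zero_eq_bot]

/-- Distributing leaves a stray `0 * y`, which `x * y` absorbs because `0 * (x * y) = 0 * x + 0 *
y`. Error terms thus move freely out of products. -/
theorem add_mul_zero_mul (x y z : A) : (x + 0 * z) * y = x * y + 0 * z := by
  calc (x + 0 * z) * y = x * y + (0 * x + 0 * y) * 1 + 0 * z := ?_
    _ = x * y + 0 * z := by rw [mul_one, ← zero_mul_mul, add_zero_mul_self]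
  have h : (x + 0 * z) * y = x * y + 0 * (x * y) + 0 * z + 0 * y := by
    rw [add_mul, mul_assoc 0, zero_mul_mul, add_zero_mul_self, add_assoc]
  rw [h, mul_one, zero_mul_mul]
  calc x * y + (0 * x + 0 * y) + 0 * z + 0 * y
      = x * y + (0 * x + (0 * y + 0 * y)) + 0 * z := by abel
    _ = _ := by rw [zero_mul_add_zero_mul]

theorem add_zero_mul_mul_add_zero_mul (x y z : A) :
    (x + 0 * z) * (y + 0 * z) = x * y + 0 * z := by
  rw [add_mul_zero_mul, mul_comm x, add_mul_zero_mul, add_assoc, zero_mul_add_zero_mul, mul_comm]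

theorem add_zero_mul_div (x y z : A) : (x + 0 * z) / y = x / y + 0 * z := by
  rw [div_eq_mul_one_div, add_mul_zero_mul, ← div_eq_mul_one_div]

theorem add_zero_mul_div_add_zero_mul (x y z : A) :
    (x + 0 * z) / (y + 0 * z) = x / y + 0 * z := by
  rw [div_add_zero_mul, add_assoc, zero_mul_add_zero_mul, add_zero_mul_div]

theorem div_div_div_eq (a b u v : A) : (a / b) / (u / v) = (a * (v * v)) / (b * (u * v)) := by
  rw [div_div_eq, div_mul_div_eq]

/-- Compute `x / y + 0 / y` in two ways: by the addition axiom for fractions, and by factoring out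
`1 / y`. -/
theorem mul_div_mul_self (x y : A) : (x * y) / (y * y) = x / y := by
  have h := div_add_div_eq x y 0 y
  have h1 : x * y + y * 0 = x * y := by rw [mul_comm y 0, ← add_mul, add_zero]
  rw [h1, div_eq_mul_one_div x y, div_eq_mul_one_div 0 y, ← add_mul, add_zero,
    ← div_eq_mul_one_div] at h
  exact h.symm

/-- Cancelling `b` is harmless once `x / y` has `1 / b` as a factor, since `1 / b` absorbs `b / b`.
-/
theorem mul_div_mul_of_eq_div_mul {x y z b w : A} (h : x / y = z / (b * w)) :
    (x * b) / (y * b) = x / y := by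
  have hb : (1 / b) * (b / b) = 1 / b := by
    rw [div_mul_div_eq, one_mul, ← mul_div_mul_self 1 b, one_mul]
  have hz : z / (b * w) = (1 / b) * (z / w) := by rw [div_mul_div_eq, one_mul]
  rw [← div_mul_div_eq, h, hz, mul_right_comm, hb]

/-! ### The commutative rings inside a model -/

/-- The elements `x` with `0 · x = 0 · c`. They form a commutative ring. -/
def Fiber (c : A) : Type u := {x : A // 0 * x = 0 * c}

namespace Fiber

variable {c : A}

theorem ext {x y : Fiber c} (h : x.1 = y.1) : x = y := Subtype.ext h

instance : Zero (Fiber c) := ⟨⟨0 * c, zero_mul_zero_mul c⟩⟩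
instance : One (Fiber c) :=
  ⟨⟨1 + 0 * c, by rw [mul_add, mul_one, zero_mul_zero_mul, zero_add]⟩⟩
instance : Add (Fiber c) :=
  ⟨fun x y => ⟨x.1 + y.1, by rw [mul_add, x.2, y.2, zero_mul_add_zero_mul]⟩⟩
instance : Mul (Fiber c) :=
  ⟨fun x y => ⟨x.1 * y.1, by rw [zero_mul_mul, x.2, y.2, zero_mul_add_zero_mul]⟩⟩
instance : Neg (Fiber c) := ⟨fun x => ⟨-x.1, by rw [zero_mul_neg, x.2]⟩⟩

theorem val_zero : (0 : Fiber c).1 = 0 * c := rfl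
theorem val_one : (1 : Fiber c).1 = 1 + 0 * c := rfl
theorem val_add (x y : Fiber c) : (x + y).1 = x.1 + y.1 := rfl
theorem val_mul (x y : Fiber c) : (x * y).1 = x.1 * y.1 := rfl
theorem val_neg (x : Fiber c) : (-x).1 = -x.1 := rfl

theorem val_add_zero_mul (x : Fiber c) : x.1 + 0 * c = x.1 := by
  have h := add_zero_mul_self x.1
  rwa [x.2] at h

theorem zero_add' (x : Fiber c) : 0 + x = x :=
  ext (by rw [val_add, val_zero, add_comm, val_add_zero_mul])

theorem add_comm' (x y : Fiber c) : x + y = y + x := ext (add_comm x.1 y.1)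

theorem mul_comm' (x y : Fiber c) : x * y = y * x := ext (mul_comm x.1 y.1)

theorem zero_mul' (x : Fiber c) : 0 * x = 0 :=
  ext (by rw [val_mul, val_zero, mul_assoc, zero_mul_mul, x.2, zero_mul_add_zero_mul])

theorem one_mul' (x : Fiber c) : 1 * x = x :=
  ext (by rw [val_mul, val_one, add_mul_zero_mul, one_mul, val_add_zero_mul])

theorem left_distrib' (x y z : Fiber c) : x * (y + z) = x * y + x * z :=
  ext (mul_add x.1 y.1 z.1)

instance : CommRing (Fiber c) where
  add_assoc x y z := ext (add_assoc x.1 y.1 z.1)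
  zero_add := zero_add'
  add_zero x := by rw [add_comm', zero_add']
  add_comm := add_comm'
  nsmul := nsmulRec
  zsmul := zsmulRec
  left_distrib := left_distrib'
  right_distrib x y z := by
    rw [mul_comm', left_distrib', mul_comm' z x, mul_comm' z y]
  zero_mul := zero_mul'
  mul_zero x := by rw [mul_comm', zero_mul']
  mul_assoc x y z := ext (mul_assoc x.1 y.1 z.1)
  one_mul := one_mul'
  mul_one x := by rw [mul_comm', one_mul']
  mul_comm := mul_comm'
  neg_add_cancel x := ext (by rw [val_add, val_neg, add_comm, add_neg_self, x.2, val_zero])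

theorem div_eq_mul_pow_div_pow (x y : Fiber c) (n : ℕ) :
    x.1 / y.1 = (x * y ^ n).1 / (y ^ (n + 1)).1 := by
  induction n with
  | zero => simp
  | succ n ih =>
    have key (a b d : A) : (a * d) / (b * d * d) = a / (b * d) := by
      have h : d / (d * d) = 1 / d := by simpa only [one_mul] using mul_div_mul_self 1 d
      rw [mul_assoc, ← div_mul_div_eq, h, div_mul_div_eq, mul_one]
    rw [ih, pow_succ y (n + 1), pow_succ y n, ← mul_assoc]
    simp only [val_mul]
    rw [key]

theorem div_eq_mul_div_mul_of_dvd_pow {x y z : Fiber c} {n : ℕ} (h : z ∣ y ^ n) :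
    x.1 / y.1 = (x * z).1 / (y * z).1 := by
  -- The exponent is raised by one to match the denominator `y ^ (n + 1)` of the expanded fraction,
  -- which then has `z` as a factor.
  obtain ⟨w, hw⟩ := h.trans (pow_dvd_pow y n.le_succ)
  refine (mul_div_mul_of_eq_div_mul (w := w.1) (z := (x * y ^ n).1) ?_).symm
  rw [div_eq_mul_pow_div_pow x y n, hw, val_mul z w]

end Fiber

end FtcAlgebra

/-! ### Terms modulo provable equality as a model -/

section Quotient

/-- Provable equality of terms. -/
def provableSetoid : Setoid Term where
  r s t := Derivable ftcCm (s ≐ t)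
  iseqv := ⟨Derivable.refl, Derivable.symm, Derivable.trans⟩

/-- The free algebra: terms modulo provable equality. -/
def FreeFtc : Type := Quotient provableSetoid

/-- The class of a term modulo provable equality. -/
def cls (t : Term) : FreeFtc := Quotient.mk provableSetoid t

theorem cls_eq_iff {s t : Term} : cls s = cls t ↔ Derivable ftcCm (s ≐ t) :=
  Quotient.eq (r := provableSetoid)

instance : Zero FreeFtc := ⟨cls 0⟩
instance : One FreeFtc := ⟨cls 1⟩
instance : Bot FreeFtc := ⟨cls ⊥⟩
instance : Neg FreeFtc :=
  ⟨Quotient.map (sa := provableSetoid) (sb := provableSetoid) (-·) fun _ _ h => h.neg_congr⟩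
instance : Add FreeFtc :=
  ⟨Quotient.map₂ (sa := provableSetoid) (sb := provableSetoid) (sc := provableSetoid) (· + ·)
    fun _ _ h _ _ h' => h.add_congr h'⟩
instance : Mul FreeFtc :=
  ⟨Quotient.map₂ (sa := provableSetoid) (sb := provableSetoid) (sc := provableSetoid) (· * ·)
    fun _ _ h _ _ h' => h.mul_congr h'⟩
instance : Div FreeFtc :=
  ⟨Quotient.map₂ (sa := provableSetoid) (sb := provableSetoid) (sc := provableSetoid) (· / ·)
    fun _ _ h _ _ h' => h.div_congr h'⟩

theorem cls_zero : cls .zero = 0 := rfl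
theorem cls_one : cls .one = 1 := rfl
theorem cls_bot : cls .bot = ⊥ := rfl
theorem cls_neg (s : Term) : cls (.neg s) = -cls s := rfl
theorem cls_add (s t : Term) : cls (.add s t) = cls s + cls t := rfl
theorem cls_mul (s t : Term) : cls (.mul s t) = cls s * cls t := rfl
theorem cls_div (s t : Term) : cls (.div s t) = cls s / cls t := rfl

/-- The substitution of five given terms for the first five variables. -/
def subst₅ (x y z u v : Term) : ℕ → Term
  | 0 => x
  | 1 => y
  | 2 => z
  | 3 => u
  | _ => v

theorem cls_subst_eq {e : Equation} (h : e ∈ ftcCm) (x y z u v : Term) :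
    cls (e.lhs.subst (subst₅ x y z u v)) = cls (e.rhs.subst (subst₅ x y z u v)) :=
  cls_eq_iff.2 ((Derivable.ax h).subst _)

theorem FreeFtc.exists_cls (a : FreeFtc) : ∃ t, cls t = a := Quotient.exists_rep a

theorem FreeFtc.add_comm' (a b : FreeFtc) : a + b = b + a := by
  obtain ⟨x, rfl⟩ := a.exists_cls
  obtain ⟨y, rfl⟩ := b.exists_cls
  exact cls_subst_eq (e := .var 0 + .var 1 ≐ .var 1 + .var 0)
      (Or.inl <| Or.inr <| Or.inl rfl) x y 0 0 0

theorem FreeFtc.mul_comm' (a b : FreeFtc) : a * b = b * a := by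
  obtain ⟨x, rfl⟩ := a.exists_cls
  obtain ⟨y, rfl⟩ := b.exists_cls
  exact cls_subst_eq (e := .var 0 * .var 1 ≐ .var 1 * .var 0)
      (Or.inl <| Or.inr <| Or.inr <| Or.inr <| Or.inr <| Or.inr <| Or.inl rfl) x y 0 0 0

theorem FreeFtc.add_zero' (a : FreeFtc) : a + 0 = a := by
  obtain ⟨x, rfl⟩ := a.exists_cls
  exact cls_subst_eq (e := .var 0 + 0 ≐ .var 0)
      (Or.inl <| Or.inr <| Or.inr <| Or.inl rfl) x 0 0 0 0

theorem FreeFtc.one_mul' (a : FreeFtc) : 1 * a = a := by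
  obtain ⟨x, rfl⟩ := a.exists_cls
  exact cls_subst_eq (e := 1 * .var 0 ≐ .var 0)
      (Or.inl <| Or.inr <| Or.inr <| Or.inr <| Or.inr <| Or.inr <| Or.inr <| Or.inl rfl) x 0 0 0 0

theorem FreeFtc.mul_add' (a b c : FreeFtc) : a * (b + c) = a * b + a * c := by
  obtain ⟨x, rfl⟩ := a.exists_cls
  obtain ⟨y, rfl⟩ := b.exists_cls
  obtain ⟨z, rfl⟩ := c.exists_cls
  exact cls_subst_eq (e := .var 0 * (.var 1 + .var 2) ≐ (.var 0 * .var 1) + (.var 0 * .var 2))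
      (Or.inl <| Or.inr <| Or.inr <| Or.inr <| Or.inr <| Or.inr <|
        Or.inr <| Or.inr <| Or.inl rfl) x y z 0 0

instance : FtcAlgebra FreeFtc where
  add_assoc a b c := by
    obtain ⟨x, rfl⟩ := a.exists_cls
    obtain ⟨y, rfl⟩ := b.exists_cls
    obtain ⟨z, rfl⟩ := c.exists_cls
    exact cls_subst_eq (e := (.var 0 + .var 1) + .var 2 ≐ .var 0 + (.var 1 + .var 2))
      (Or.inl <| Or.inl rfl) x y z 0 0
  add_comm := FreeFtc.add_comm'
  add_zero := FreeFtc.add_zero'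
  zero_add a := by rw [FreeFtc.add_comm', FreeFtc.add_zero']
  nsmul := nsmulRec
  mul_assoc a b c := by
    obtain ⟨x, rfl⟩ := a.exists_cls
    obtain ⟨y, rfl⟩ := b.exists_cls
    obtain ⟨z, rfl⟩ := c.exists_cls
    exact (cls_subst_eq (e := .var 0 * (.var 1 * .var 2) ≐ (.var 0 * .var 1) * .var 2)
      (Or.inl <| Or.inr <| Or.inr <| Or.inr <| Or.inr <| Or.inl rfl) x y z 0 0).symm
  mul_comm := FreeFtc.mul_comm'
  one_mul := FreeFtc.one_mul'
  mul_one a := by rw [FreeFtc.mul_comm', FreeFtc.one_mul']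
  left_distrib := FreeFtc.mul_add'
  right_distrib a b c := by
    rw [FreeFtc.mul_comm', FreeFtc.mul_add', FreeFtc.mul_comm' c a, FreeFtc.mul_comm' c b]
  neg_neg a := by
    obtain ⟨x, rfl⟩ := a.exists_cls
    exact cls_subst_eq (e := -(-.var 0) ≐ .var 0)
      (Or.inl <| Or.inr <| Or.inr <| Or.inr <| Or.inr <| Or.inr <|
        Or.inr <| Or.inr <| Or.inr <| Or.inl rfl) x 0 0 0 0
  add_neg_self a := by
    obtain ⟨x, rfl⟩ := a.exists_cls
    exact cls_subst_eq (e := .var 0 + (-.var 0) ≐ 0 * .var 0)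
      (Or.inl <| Or.inr <| Or.inr <| Or.inr <| Or.inl rfl) x 0 0 0 0
  zero_mul_add_eq a b := by
    obtain ⟨x, rfl⟩ := a.exists_cls
    obtain ⟨y, rfl⟩ := b.exists_cls
    exact cls_subst_eq (e := 0 * (.var 0 + .var 1) ≐ 0 * (.var 0 * .var 1))
      (Or.inl <| Or.inr <| Or.inr <| Or.inr <| Or.inr <| Or.inr <|
        Or.inr <| Or.inr <| Or.inr <| Or.inr <| Or.inl rfl) x y 0 0 0
  add_bot a := by
    obtain ⟨x, rfl⟩ := a.exists_cls
    exact cls_subst_eq (e := Term.var 0 + ⊥ ≐ ⊥)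
      (Or.inl <| Or.inr <| Or.inr <| Or.inr <| Or.inr <| Or.inr <|
        Or.inr <| Or.inr <| Or.inr <| Or.inr <| Or.inr <| rfl) x 0 0 0 0
  div_one_eq a := by
    obtain ⟨x, rfl⟩ := a.exists_cls
    exact (cls_subst_eq (e := .var 0 ≐ .var 0 / 1)
      (Or.inr <| Or.inl rfl) x 0 0 0 0).symm
  neg_div_eq a b := by
    obtain ⟨x, rfl⟩ := a.exists_cls
    obtain ⟨y, rfl⟩ := b.exists_cls
    exact cls_subst_eq (e := -(.var 0 / .var 1) ≐ (-.var 0) / .var 1)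
      (Or.inr <| Or.inr <| Or.inl rfl) x y 0 0 0
  div_mul_div_eq a b c d := by
    obtain ⟨x, rfl⟩ := a.exists_cls
    obtain ⟨y, rfl⟩ := b.exists_cls
    obtain ⟨u, rfl⟩ := c.exists_cls
    obtain ⟨v, rfl⟩ := d.exists_cls
    exact cls_subst_eq
      (e := (.var 0 / .var 1) * (.var 3 / .var 4) ≐ (.var 0 * .var 3) / (.var 1 * .var 4))
      (Or.inr <| Or.inr <| Or.inr <| Or.inl rfl) x y 0 u v
  div_add_div_eq a b c d := by
    obtain ⟨x, rfl⟩ := a.exists_cls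
    obtain ⟨y, rfl⟩ := b.exists_cls
    obtain ⟨u, rfl⟩ := c.exists_cls
    obtain ⟨v, rfl⟩ := d.exists_cls
    exact cls_subst_eq
      (e := (.var 0 / .var 1) + (.var 3 / .var 4) ≐
        ((.var 0 * .var 4) + (.var 1 * .var 3)) / (.var 1 * .var 4))
      (Or.inr <| Or.inr <| Or.inr <| Or.inr <| Or.inl rfl) x y 0 u v
  div_div_eq a c d := by
    obtain ⟨x, rfl⟩ := a.exists_cls
    obtain ⟨u, rfl⟩ := c.exists_cls
    obtain ⟨v, rfl⟩ := d.exists_cls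
    exact cls_subst_eq
      (e := .var 0 / (.var 3 / .var 4) ≐ .var 0 * ((.var 4 * .var 4) / (.var 3 * .var 4)))
      (Or.inr <| Or.inr <| Or.inr <| Or.inr <| Or.inr <| Or.inl rfl) x 0 0 u v
  div_add_zero_mul a b c := by
    obtain ⟨x, rfl⟩ := a.exists_cls
    obtain ⟨y, rfl⟩ := b.exists_cls
    obtain ⟨z, rfl⟩ := c.exists_cls
    exact cls_subst_eq (e := .var 0 / (.var 1 + 0 * .var 2) ≐ (.var 0 + 0 * .var 2) / .var 1)
      (Or.inr <| Or.inr <| Or.inr <| Or.inr <| Or.inr <| Or.inr <| Or.inl rfl) x y z 0 0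
  bot_eq := cls_subst_eq (e := ⊥ ≐ 1 / 0)
      (Or.inr <| Or.inr <| Or.inr <| Or.inr <| Or.inr <| Or.inr <| Or.inr <| rfl) 0 0 0 0 0

end Quotient

/-! ### Reduction of terms to flat fractions -/

namespace Term

/-- The set of variables occurring in a term. -/
def vars : Term → Finset ℕ
  | .var n => {n}
  | .zero => ∅
  | .one => ∅
  | .bot => ∅
  | .neg t => t.vars
  | .add s t => s.vars ∪ t.vars
  | .mul s t => s.vars ∪ t.vars
  | .div s t => s.vars ∪ t.vars

/-- The numerator and the denominator of a flat fraction equivalent to a term. -/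
noncomputable def frac : Term → MvPolynomial ℕ ℤ × MvPolynomial ℕ ℤ
  | .var n => (X n, 1)
  | .zero => (0, 1)
  | .one => (1, 1)
  | .bot => (1, 0)
  | .neg t => (-t.frac.1, t.frac.2)
  | .add s t => (s.frac.1 * t.frac.2 + s.frac.2 * t.frac.1, s.frac.2 * t.frac.2)
  | .mul s t => (s.frac.1 * t.frac.1, s.frac.2 * t.frac.2)
  | .div s t => (s.frac.1 * (t.frac.2 * t.frac.2), s.frac.2 * (t.frac.1 * t.frac.2))

end Term

section Syntactic

open FtcAlgebra

/-- Every operation lets an error term pass from an argument to the result, so a term absorbs `0 ·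
Xᵢ` for each variable in it. -/
theorem cls_add_zero_mul_var {t : Term} {i : ℕ} (hi : i ∈ t.vars) :
    cls t + 0 * cls (.var i) = cls t := by
  induction t with
  | var n =>
    obtain rfl : i = n := by simpa [Term.vars] using hi
    exact add_zero_mul_self _
  | zero => simp [Term.vars] at hi
  | one => simp [Term.vars] at hi
  | bot => simp [Term.vars] at hi
  | neg t ih =>
    rw [cls_neg, ← neg_zero_mul, ← neg_add_eq, ih hi]
  | add s t ihs iht =>
    rw [cls_add]
    rcases Finset.mem_union.1 hi with h | h
    · rw [add_right_comm, ihs h]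
    · rw [add_assoc, iht h]
  | mul s t ihs iht =>
    rw [cls_mul]
    rcases Finset.mem_union.1 hi with h | h
    · rw [← add_mul_zero_mul, ihs h]
    · rw [mul_comm, ← add_mul_zero_mul, iht h]
  | div s t ihs iht =>
    rw [cls_div]
    rcases Finset.mem_union.1 hi with h | h
    · rw [← add_zero_mul_div, ihs h]
    · rw [← add_zero_mul_div, ← div_add_zero_mul, iht h]

theorem cls_add_zero_mul_sum (t : Term) {V : Finset ℕ} (hV : V ⊆ t.vars) :
    cls t + 0 * ∑ i ∈ V, cls (.var i) = cls t := by
  induction V using Finset.induction_on with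
  | empty => rw [Finset.sum_empty, zero_mul_zero, add_zero]
  | insert i V hi ih =>
    rw [Finset.insert_subset_iff] at hV
    rw [Finset.sum_insert hi, mul_add, ← add_assoc, cls_add_zero_mul_var hV.1, ih hV.2]

theorem zero_mul_var_add_zero_mul_sum {V : Finset ℕ} {i : ℕ} (hi : i ∈ V) :
    0 * cls (.var i) + 0 * ∑ j ∈ V, cls (.var j) = 0 * ∑ j ∈ V, cls (.var j) := by
  rw [← Finset.add_sum_erase V _ hi, mul_add, ← add_assoc, zero_mul_add_zero_mul]

open Classical in
/-- The ring of classes `x` with `0 · x` the sum of all `0 · Xᵢ`, `i ∈ V`, as the target of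
the evaluation of integer polynomials. -/
noncomputable def toFiber (V : Finset ℕ) :
    MvPolynomial ℕ ℤ →+* Fiber (∑ i ∈ V, cls (.var i)) :=
  eval₂Hom (Int.castRingHom _) fun i =>
    if hi : i ∈ V then
      ⟨cls (.var i) + 0 * ∑ j ∈ V, cls (.var j), by
        rw [mul_add, zero_mul_zero_mul, zero_mul_var_add_zero_mul_sum hi]⟩
    -- Arbitrary value: only variables in `V` are ever evaluated through `toFiber_X`.
    else 0

theorem toFiber_X {V : Finset ℕ} {i : ℕ} (hi : i ∈ V) :
    (toFiber V (X i)).1 = cls (.var i) + 0 * ∑ j ∈ V, cls (.var j) := by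
  simp [toFiber, hi]

/-- The fraction axioms mirror the clauses of `Term.frac`. A set `V` larger than `t.vars` is allowed
so that the induction reaches subterms with a fixed ring. -/
theorem cls_add_eq_div (t : Term) {V : Finset ℕ} (hV : t.vars ⊆ V) :
    cls t + 0 * ∑ j ∈ V, cls (.var j) =
      (toFiber V t.frac.1).1 / (toFiber V t.frac.2).1 := by
  induction t with
  | var n =>
    rw [Term.frac, toFiber_X (hV (by simp [Term.vars])), map_one, Fiber.val_one,
      add_zero_mul_div_add_zero_mul, div_one_eq]
  | zero =>
    rw [Term.frac, map_one, map_zero, Fiber.val_one, Fiber.val_zero, cls_zero,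
      zero_add, div_add_zero_mul, zero_mul_add_zero_mul, div_one_eq]
  | one =>
    rw [Term.frac, map_one, Fiber.val_one, cls_one, add_zero_mul_div_add_zero_mul, div_one_eq]
  | bot =>
    rw [Term.frac, map_one, map_zero, Fiber.val_one, Fiber.val_zero, cls_bot, bot_add,
      div_zero_mul]
  | neg t ih =>
    rw [Term.frac, map_neg, Fiber.val_neg, ← neg_div_eq, ← ih hV, neg_add_eq, neg_zero_mul, cls_neg]
  | add s t ihs iht =>
    obtain ⟨hs, ht⟩ := Finset.union_subset_iff.1 hV
    simp only [Term.frac, map_add, map_mul, Fiber.val_add, Fiber.val_mul]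
    rw [← div_add_div_eq, ← ihs hs, ← iht ht, add_add_add_comm, zero_mul_add_zero_mul, cls_add]
  | mul s t ihs iht =>
    obtain ⟨hs, ht⟩ := Finset.union_subset_iff.1 hV
    simp only [Term.frac, map_mul, Fiber.val_mul]
    rw [← div_mul_div_eq, ← ihs hs, ← iht ht, add_zero_mul_mul_add_zero_mul, cls_mul]
  | div s t ihs iht =>
    obtain ⟨hs, ht⟩ := Finset.union_subset_iff.1 hV
    simp only [Term.frac, map_mul, Fiber.val_mul]
    rw [← FtcAlgebra.div_div_div_eq, ← ihs hs, ← iht ht, add_zero_mul_div_add_zero_mul, cls_div]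

theorem cls_eq_div (t : Term) :
    cls t = (toFiber t.vars t.frac.1).1 / (toFiber t.vars t.frac.2).1 := by
  rw [← cls_add_eq_div t subset_rfl, cls_add_zero_mul_sum t subset_rfl]

theorem cls_eq_bot {t : Term} (h : t.frac.2 = 0) : cls t = ⊥ := by
  rw [cls_eq_div, h, map_zero, Fiber.val_zero, div_zero_mul]

/-- Equal variable sets put both fractions over one ring; the divisibilities let each be expanded by
the other's denominator. -/
theorem cls_eq_of_frac {t r : Term} (hv : t.vars = r.vars) {m n : ℕ}
    (hm : t.frac.2 ∣ r.frac.2 ^ m) (hn : r.frac.2 ∣ t.frac.2 ^ n)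
    (h : t.frac.1 * r.frac.2 = r.frac.1 * t.frac.2) : cls t = cls r := by
  rw [cls_eq_div t, cls_eq_div r, ← hv]
  have hm' := map_dvd (toFiber t.vars) hm
  have hn' := map_dvd (toFiber t.vars) hn
  rw [map_pow] at hm' hn'
  rw [Fiber.div_eq_mul_div_mul_of_dvd_pow hn', Fiber.div_eq_mul_div_mul_of_dvd_pow hm',
    ← map_mul, ← map_mul, ← map_mul, ← map_mul, h, mul_comm t.frac.2]

end Syntactic

/-! ### Evaluation in fields and completeness -/

section Semantic

variable {F : Type u} [Field F]

theorem partialDiv_eq_none_iff {x y : F} : partialDiv x y = none ↔ y = 0 := by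
  unfold partialDiv; split_ifs <;> simp_all

theorem partialDiv_of_ne {x y : F} (h : y ≠ 0) : partialDiv x y = some (x / y) := by
  simp [partialDiv, h, div_eq_mul_inv]

theorem eval_enl (ρ : ℕ → F) (t : Term) :
    t.eval (enl F) (fun i => some (ρ i)) =
      partialDiv (aeval ρ t.frac.1) (aeval ρ t.frac.2) := by
  induction t with
  | var n => simp [Term.eval, Term.frac, partialDiv]
  | zero => simp [Term.eval, Term.frac, partialDiv, enl]
  | one => simp [Term.eval, Term.frac, partialDiv, enl]
  | bot => simp [Term.eval, Term.frac, partialDiv, enl]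
  | neg t ih =>
    simp only [Term.eval, Term.frac, ih, map_neg]
    by_cases h : aeval ρ t.frac.2 = 0 <;> simp [partialDiv, enl, h]
  | add s t ihs iht =>
    simp only [Term.eval, Term.frac, ihs, iht, map_add, map_mul]
    by_cases hs : aeval ρ s.frac.2 = 0 <;> by_cases ht : aeval ρ t.frac.2 = 0 <;>
      simp [partialDiv, enl, hs, ht]
    field_simp
  | mul s t ihs iht =>
    simp only [Term.eval, Term.frac, ihs, iht, map_mul]
    by_cases hs : aeval ρ s.frac.2 = 0 <;> by_cases ht : aeval ρ t.frac.2 = 0 <;>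
      simp [partialDiv, enl, hs, ht]
    field_simp
  | div s t ihs iht =>
    simp only [Term.eval, Term.frac, ihs, iht, map_mul]
    by_cases hs : aeval ρ s.frac.2 = 0 <;> by_cases ht : aeval ρ t.frac.2 = 0 <;>
      by_cases ht' : aeval ρ t.frac.1 = 0 <;> simp [partialDiv, enl, hs, ht, ht']
    field_simp

theorem eval_enl_eq_none {ρ : ℕ → Option F} {t : Term} {i : ℕ} (hi : i ∈ t.vars)
    (h : ρ i = none) : t.eval (enl F) ρ = none := by
  induction t with
  | var n =>
    obtain rfl : i = n := by simpa [Term.vars] using hi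
    exact h
  | zero => simp [Term.vars] at hi
  | one => simp [Term.vars] at hi
  | bot => simp [Term.vars] at hi
  | neg t ih => simp only [Term.eval, ih hi]; rfl
  | add s t ihs iht =>
    rcases Finset.mem_union.1 hi with h | h
    · simp only [Term.eval, ihs h]; simp [enl]
    · simp only [Term.eval, iht h]; simp [enl]
  | mul s t ihs iht =>
    rcases Finset.mem_union.1 hi with h | h
    · simp only [Term.eval, ihs h]; simp [enl]
    · simp only [Term.eval, iht h]; simp [enl]
  | div s t ihs iht =>
    rcases Finset.mem_union.1 hi with h | h
    · simp only [Term.eval, ihs h]; simp [enl]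
    · simp only [Term.eval, iht h]; simp [enl]

theorem eval_congr {A : Type u} {𝔸 : CMAlgebra A} {ρ ρ' : ℕ → A} {t : Term}
    (h : ∀ i ∈ t.vars, ρ i = ρ' i) : t.eval 𝔸 ρ = t.eval 𝔸 ρ' := by
  induction t with
  | var n => exact h n (by simp [Term.vars])
  | zero => rfl
  | one => rfl
  | bot => rfl
  | neg t ih => rw [Term.eval, Term.eval, ih h]
  | add s t ihs iht | mul s t ihs iht | div s t ihs iht =>
    rw [Term.eval, Term.eval, ihs fun i hi => h i (Finset.mem_union_left _ hi),
      iht fun i hi => h i (Finset.mem_union_right _ hi)]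

theorem eval_subst {A : Type u} (𝔸 : CMAlgebra A) (ρ : ℕ → A) (σ : ℕ → Term) (t : Term) :
    (t.subst σ).eval 𝔸 ρ = t.eval 𝔸 fun i => (σ i).eval 𝔸 ρ := by
  induction t <;> simp_all [Term.subst, Term.eval]

/-- Assigning `⊥` to a variable of `t` missing from `r` would make `t` undefined but leave `r` with
its defined value. -/
theorem vars_subset_of_eval_eq {t r : Term} {ρ : ℕ → F}
    (h : (enl F).Satisfies (t ≐ r)) (hr : aeval ρ r.frac.2 ≠ 0) : t.vars ⊆ r.vars := by
  intro i hi
  by_contra hir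
  have h1 := h (Function.update (fun j => some (ρ j)) i none)
  rw [eval_enl_eq_none hi (by simp)] at h1
  have h2 : r.eval (enl F) (Function.update (fun j => some (ρ j)) i none) =
      r.eval (enl F) (fun j => some (ρ j)) :=
    eval_congr fun j hj => Function.update_of_ne (by rintro rfl; exact hir hj) _ _
  rw [h2, eval_enl, eq_comm, partialDiv_eq_none_iff] at h1
  exact hr h1

theorem aeval_ringHom_X (f : MvPolynomial ℕ ℤ →+* F) (p : MvPolynomial ℕ ℤ) :
    aeval (fun i => f (X i)) p = f p := by
  have h : (aeval fun i => f (X i) : MvPolynomial ℕ ℤ →ₐ[ℤ] F).toRingHom = f :=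
    MvPolynomial.ringHom_ext' (Subsingleton.elim _ _) (fun i => by simp)
  exact congrArg (fun g => g p) h

/-- The residue field at `P`, with the variables sent to their classes; `ULift` moves it to the
required universe. -/
theorem exists_field_of_isPrime (P : Ideal (MvPolynomial ℕ ℤ)) [P.IsPrime] :
    ∃ (F : Type u) (_ : Field F) (ρ : ℕ → F),
      ∀ p : MvPolynomial ℕ ℤ, aeval ρ p = 0 ↔ p ∈ P := by
  let K := FractionRing (MvPolynomial ℕ ℤ ⧸ P)
  let f : MvPolynomial ℕ ℤ →+* ULift.{u} K :=
    (ULift.ringEquiv.symm.toRingHom.comp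
      (algebraMap (MvPolynomial ℕ ℤ ⧸ P) K)).comp (Ideal.Quotient.mk P)
  refine ⟨ULift.{u} K, inferInstance, fun i => f (X i), fun p => ?_⟩
  rw [aeval_ringHom_X]
  simp only [f, RingHom.comp_apply]
  rw [RingEquiv.toRingHom_eq_coe, RingHom.coe_coe, map_eq_zero_iff _ (RingEquiv.injective _),
    map_eq_zero_iff _ (IsFractionRing.injective (MvPolynomial ℕ ℤ ⧸ P) K),
    Ideal.Quotient.eq_zero_iff_mem]

theorem frac_mem_iff {t r : Term} (h : ∀ (F : Type u) [Field F], (enl F).Satisfies (t ≐ r))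
    (P : Ideal (MvPolynomial ℕ ℤ)) [P.IsPrime] : t.frac.2 ∈ P ↔ r.frac.2 ∈ P := by
  obtain ⟨F, _, ρ, hρ⟩ := exists_field_of_isPrime.{u} P
  have h1 := h F fun i => some (ρ i)
  rw [eval_enl, eval_enl] at h1
  rw [← hρ, ← hρ, ← partialDiv_eq_none_iff (x := aeval ρ t.frac.1),
    ← partialDiv_eq_none_iff (x := aeval ρ r.frac.1), h1]

/-- The radical of a principal ideal is the intersection of the primes containing it, and the
denominators lie in the same primes. -/
theorem exists_dvd_pow {t r : Term}
    (h : ∀ (F : Type u) [Field F], (enl F).Satisfies (t ≐ r)) :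
    ∃ n, t.frac.2 ∣ r.frac.2 ^ n := by
  have : r.frac.2 ∈ (Ideal.span {t.frac.2}).radical := by
    rw [Ideal.radical_eq_sInf, Ideal.mem_sInf]
    rintro P ⟨hP, hP'⟩
    exact (frac_mem_iff h P).1 (hP (Ideal.mem_span_singleton_self _))
  obtain ⟨n, hn⟩ := this
  exact ⟨n, Ideal.mem_span_singleton.1 hn⟩

theorem derivable_of_satisfies {t r : Term}
    (h : ∀ (F : Type u) [Field F], (enl F).Satisfies (t ≐ r)) : Derivable ftcCm (t ≐ r) := by
  rw [← cls_eq_iff]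
  have h' : ∀ (F : Type u) [Field F], (enl F).Satisfies (r ≐ t) := fun F _ ρ => (h F ρ).symm
  have h0 : t.frac.2 = 0 ↔ r.frac.2 = 0 := by
    simpa only [Ideal.mem_bot] using frac_mem_iff h ⊥
  by_cases ht : t.frac.2 = 0
  -- Here the variable sets may differ, but both terms collapse to `⊥`.
  · rw [cls_eq_bot ht, cls_eq_bot (h0.1 ht)]
  obtain ⟨m, hm⟩ := exists_dvd_pow h
  obtain ⟨n, hn⟩ := exists_dvd_pow h'
  -- At the zero prime evaluation is injective, so one generic point detects polynomial identities.
  obtain ⟨F, _, ρ, hρ⟩ := exists_field_of_isPrime.{u} (⊥ : Ideal (MvPolynomial ℕ ℤ))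
  simp only [Ideal.mem_bot] at hρ
  have hr' : aeval ρ r.frac.2 ≠ 0 := fun hr => ht (h0.2 ((hρ _).1 hr))
  have ht' : aeval ρ t.frac.2 ≠ 0 := fun hr => ht ((hρ _).1 hr)
  refine cls_eq_of_frac ((vars_subset_of_eval_eq (h F) hr').antisymm
    (vars_subset_of_eval_eq (h' F) ht')) hm hn ?_
  have h1 := h F fun i => some (ρ i)
  rw [eval_enl, eval_enl, partialDiv_of_ne hr', partialDiv_of_ne ht', Option.some_inj,
    div_eq_div_iff ht' hr'] at h1
  rw [← sub_eq_zero, ← hρ, map_sub, map_mul, map_mul, h1, sub_self]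

end Semantic

/-! ### Soundness and finiteness -/

section Soundness

section

variable {A : Type u} (𝔸 : CMAlgebra A) (ρ : ℕ → A) (s t : Term)

theorem eval_var (n : ℕ) : (Term.var n).eval 𝔸 ρ = ρ n := rfl
theorem eval_zero : (0 : Term).eval 𝔸 ρ = 𝔸.zero := rfl
theorem eval_one : (1 : Term).eval 𝔸 ρ = 𝔸.one := rfl
theorem eval_bot : (⊥ : Term).eval 𝔸 ρ = 𝔸.bot := rfl
theorem eval_neg : (-s).eval 𝔸 ρ = 𝔸.neg (s.eval 𝔸 ρ) := rfl
theorem eval_add : (s + t).eval 𝔸 ρ = 𝔸.add (s.eval 𝔸 ρ) (t.eval 𝔸 ρ) := rfl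
theorem eval_mul : (s * t).eval 𝔸 ρ = 𝔸.mul (s.eval 𝔸 ρ) (t.eval 𝔸 ρ) := rfl
theorem eval_div : (s / t).eval 𝔸 ρ = 𝔸.div (s.eval 𝔸 ρ) (t.eval 𝔸 ρ) := rfl

end

variable {F : Type u} [Field F]

theorem enl_satisfies_wcrBot {e : Equation} (he : e ∈ wcrBot) : (enl F).Satisfies e := by
  intro ρ
  simp only [wcrBot, Set.mem_insert_iff, Set.mem_singleton_iff] at he
  rcases he with rfl | rfl | rfl | rfl | rfl | rfl | rfl | rfl | rfl | rfl | rfl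
  all_goals
    simp only [eval_var, eval_zero, eval_one, eval_bot, eval_neg, eval_add, eval_mul]
    generalize ρ 0 = x, ρ 1 = y, ρ 2 = z
    rcases x with _ | x <;> rcases y with _ | y <;> rcases z with _ | z <;>
      simp [enl] <;> ring

theorem enl_satisfies_ftcCm {e : Equation} (he : e ∈ ftcCm) : (enl F).Satisfies e := by
  rcases he with he | he
  · exact enl_satisfies_wcrBot he
  intro ρ
  simp only [Set.mem_insert_iff, Set.mem_singleton_iff] at he
  rcases he with rfl | rfl | rfl | rfl | rfl | rfl | rfl
  all_goals
    simp only [eval_var, eval_zero, eval_one, eval_bot, eval_neg, eval_add, eval_mul, eval_div]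
    generalize ρ 0 = x, ρ 1 = y, ρ 2 = z, ρ 3 = u, ρ 4 = v
  · rcases x with _ | x <;> simp [enl, partialDiv]
  · rcases x with _ | x <;> rcases y with _ | y <;> simp [enl, partialDiv]
    by_cases hy : y = 0 <;> simp [hy]
  · rcases x with _ | x <;> rcases y with _ | y <;> rcases u with _ | u <;> rcases v with _ | v <;>
      simp [enl, partialDiv]
    all_goals
      by_cases hy : y = 0 <;> by_cases hv : v = 0 <;> simp [hy, hv]
    all_goals field_simp
  · rcases x with _ | x <;> rcases y with _ | y <;> rcases u with _ | u <;> rcases v with _ | v <;>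
      simp [enl, partialDiv]
    all_goals
      by_cases hy : y = 0 <;> by_cases hv : v = 0 <;> simp [hy, hv]
    all_goals field_simp
  · rcases x with _ | x <;> rcases u with _ | u <;> rcases v with _ | v <;>
      simp [enl, partialDiv]
    all_goals
      by_cases hu : u = 0 <;> by_cases hv : v = 0 <;> simp [hu, hv]
    exact Or.inl (by field_simp)
  · rcases x with _ | x <;> rcases y with _ | y <;> rcases z with _ | z <;> simp [enl]
  · simp [enl, partialDiv]

theorem satisfies_of_derivable {e : Equation} (h : Derivable ftcCm e) :
    (enl F).Satisfies e := by
  induction h with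
  | ax he => exact enl_satisfies_ftcCm he
  | refl t => exact fun _ => rfl
  | symm _ ih => exact fun ρ => (ih ρ).symm
  | trans _ _ ih ih' => exact fun ρ => (ih ρ).trans (ih' ρ)
  | subst σ _ ih =>
    intro ρ
    simpa only [eval_subst] using ih fun i => (σ i).eval (enl F) ρ
  | neg_congr _ ih => exact fun ρ => congrArg (enl F).neg (ih ρ)
  | add_congr _ _ ih ih' => exact fun ρ => congrArg₂ (enl F).add (ih ρ) (ih' ρ)
  | mul_congr _ _ ih ih' => exact fun ρ => congrArg₂ (enl F).mul (ih ρ) (ih' ρ)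
  | div_congr _ _ ih ih' => exact fun ρ => congrArg₂ (enl F).div (ih ρ) (ih' ρ)

end Soundness

theorem ftcCm_finite : ftcCm.Finite := by
  simp [ftcCm, wcrBot]

end CommonMeadow

theorem theorem4p2 :
    CommonMeadow.ftcCm.Finite ∧
    ∀ t r : CommonMeadow.Term,
      CommonMeadow.Derivable CommonMeadow.ftcCm (CommonMeadow.Equation.mk t r) ↔
        ∀ (F : Type u) [Field F],
          (CommonMeadow.enl F).Satisfies (CommonMeadow.Equation.mk t r) := by
  exact ⟨CommonMeadow.ftcCm_finite, fun _ _ =>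
    ⟨fun h _ _ => CommonMeadow.satisfies_of_derivable h, CommonMeadow.derivable_of_satisfies⟩⟩
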